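/- Let $\mathcal{H}$ be a complex Hilbert space and let $\mathcal{B}(\mathcal{H})$ be the algebra of bounded linear operators on $\mathcal{H}$. For $T\in\mathcal{B}(\mathcal{H})$ let $W(T)=\{\langle Tu,u\rangle : u\in\mathcal{H},\ \|u\|=1\}$ be the numerical range of $T$, and for $\delta\in[0,1)$ let $$K_\delta=\Big\{x+iy : x,y\in\mathbb{R},\ \frac{x^2}{(1+\delta)^2}+\frac{y^2}{(1-\delta)^2}\le 1\Big\}.$$ A contraction is an operator of norm at most $1$; for a self-adjoint contraction $A$, the operators $\sqrt{1+A}$ and $\sqrt{1-A}$ are the positive square roots of the positive operators $1+A$ and $1-A$. Let $\delta\in[0,1)$. (i) If $\mathcal{H}$ is finite-dimensional and $T\in\mathcal{B}(\mathcal{H})$, then $W(T)\subseteq K_\delta$ if and only if there exist contractions $A,B\in\mathcal{B}(\mathcal{H})$ such that $A$ is self-adjoint and $$T=2\sqrt{\delta}\,A+(1-\delta)\sqrt{1+A}\;B\,\sqrt{1-A}.\qquad(*)$$ (ii) If $\mathcal{H}$ is an arbitrary Hilbert space (not assumed to be finite-dimensional), $A,B\in\mathcal{B}(\mathcal{H})$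 are contractions, $A$ is self-adjoint, and $T$ is defined by $(*)$, then $W(T)\subseteq K_\delta$. For $\delta=0$, where $K_0$ is the closed unit disc, $(*)$ reads $T=\sqrt{1+A}\,B\,\sqrt{1-A}$. -/

import Mathlib

/-- The numerical range `W(T) = {⟨T u, u⟩ : ‖u‖ = 1}`. Mathlib's inner product is linear in the
second variable, so `⟨T u, u⟩` (linear in the first variable) is `inner ℂ u (T u)`. -/
def numericalRange {H : Type*} [NormedAddCommGroup H] [InnerProductSpace ℂ H]
    (T : H →L[ℂ] H) : Set ℂ :=
  {z | ∃ u : H, ‖u‖ = 1 ∧ z = inner ℂ u (T u)}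

/-- The closed elliptical region
`K_δ = {x + i y : x ^ 2 / (1 + δ) ^ 2 + y ^ 2 / (1 - δ) ^ 2 ≤ 1}`, for `0 ≤ δ < 1`. -/
def ellipseK (δ : ℝ) : Set ℂ :=
  {z | z.re ^ 2 / (1 + δ) ^ 2 + z.im ^ 2 / (1 - δ) ^ 2 ≤ 1}

/-! The real-linear map `z ↦ (z - δ z̄) / (1 - δ²)` carries `K_δ` onto the unit disc, so `W(T) ⊆
K_δ` says that `S = (T - δ T*) / (1 - δ²)` has numerical radius at most 1, and `T = S + δ S*`.
Ando's theorem (`exists_blockPositive`) gives a self-adjoint `Z` with the operator matrix of rows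
`(1 + Z, S)`, `(S*, 1 - Z)` positive. Rotating it by the angle `arctan √δ` yields diagonal entries
`1 ± A` and a corner `R` with `T = 2√δ A + (1 - δ) R`. Positivity then factors `R` as `√(1 + A) B
√(1 - A)`. Ando's theorem comes from Schur complements of a positive block Toeplitz form, averaged.
Finite dimension supplies the compactness for the limits. The converse is Cauchy–Schwarz, in any
dimension. -/

/-! ### Quadratic forms, the inclusion in the ellipse, and corners of positive operator matrices. -/

section BlockPositive

variable {H : Type*} [NormedAddCommGroup H] [InnerProductSpace ℂ H]

open Filter Topology

/-- The operator matrix with rows `(P, R)` and `(R*, Q)` has nonnegative real quadratic form. -/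
def BlockPositive (P R Q : H →L[ℂ] H) : Prop :=
  ∀ x y : H, 0 ≤ (inner ℂ x (P x)).re + 2 * (inner ℂ x (R y)).re + (inner ℂ y (Q y)).re

theorem re_inner_comm (x y : H) : (inner ℂ x y).re = (inner ℂ y x).re :=
  inner_re_symm (𝕜 := ℂ) x y

theorem re_inner_self (x : H) : (inner ℂ x x).re = ‖x‖ ^ 2 :=
  inner_self_eq_norm_sq (𝕜 := ℂ) x

theorem re_inner_le_norm_mul (x y : H) : (inner ℂ x y).re ≤ ‖x‖ * ‖y‖ :=
  re_inner_le_norm (𝕜 := ℂ) x y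

theorem IsSelfAdjoint.inner_apply [CompleteSpace H] {A : H →L[ℂ] H} (hA : IsSelfAdjoint A)
    (x y : H) : inner ℂ (A x) y = inner ℂ x (A y) :=
  hA.isSymmetric x y

theorem norm_le_of_neg_two_mul_re_inner_le {B : H →L[ℂ] H}
    (h : ∀ x y : H, -(2 * (inner ℂ x (B y)).re) ≤ ‖x‖ ^ 2 + ‖y‖ ^ 2) : ‖B‖ ≤ 1 := by
  refine B.opNorm_le_bound zero_le_one fun y => ?_
  have h1 := h (-(B y)) y
  rw [inner_neg_left, Complex.neg_re, re_inner_self, norm_neg] at h1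
  rw [one_mul]
  exact abs_le_of_sq_le_sq' (by linarith) (norm_nonneg y) |>.2

/-- Polarization: subtracting the form at `x - y` from the form at `x + y` leaves `4 Re ⟨x, A y⟩`,
and the parallelogram law bounds it. -/
theorem norm_le_one_of_re_inner_le [CompleteSpace H] {A : H →L[ℂ] H} (hA : IsSelfAdjoint A)
    (h₁ : ∀ x : H, (inner ℂ x (A x)).re ≤ ‖x‖ ^ 2)
    (h₂ : ∀ x : H, -‖x‖ ^ 2 ≤ (inner ℂ x (A x)).re) : ‖A‖ ≤ 1 := by
  refine norm_le_of_neg_two_mul_re_inner_le fun x y => ?_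
  have e1 := h₂ (x + y)
  have e2 := h₁ (x - y)
  have e3 := parallelogram_law_with_norm ℂ x y
  have e4 : (inner ℂ y (A x)).re = (inner ℂ x (A y)).re := by
    rw [re_inner_comm, hA.inner_apply]
  simp only [map_add, map_sub, inner_add_left, inner_add_right, inner_sub_left, inner_sub_right,
    Complex.add_re, Complex.sub_re] at e1 e2
  nlinarith

theorem exists_inverse_of_le_re_inner [CompleteSpace H] {A : H →L[ℂ] H} (hA : IsSelfAdjoint A)
    {c : ℝ} (hc : 0 < c) (h : ∀ x : H, c * ‖x‖ ^ 2 ≤ (inner ℂ x (A x)).re) :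
    ∃ V : H →L[ℂ] H, IsSelfAdjoint V ∧ A * V = 1 ∧ V * A = 1 := by
  have hu : IsUnit A := by
    refine ContinuousLinearMap.isUnit_of_forall_le_norm_inner_map A (c := c.toNNReal)
      (Real.toNNReal_pos.mpr hc) fun x => ?_
    rw [Real.coe_toNNReal c hc.le, norm_inner_symm, mul_comm]
    exact (h x).trans (Complex.re_le_norm _)
  obtain ⟨U, rfl⟩ := hu
  have h3 : star (↑U⁻¹ : H →L[ℂ] H) * ↑U = 1 := by
    have := congrArg star U.mul_inv
    rwa [star_mul, hA.star_eq, star_one] at this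
  exact ⟨↑U⁻¹, left_inv_eq_right_inv h3 U.mul_inv, U.mul_inv, U.inv_mul⟩

theorem isPositive_of_re_inner_nonneg [CompleteSpace H] {A : H →L[ℂ] H} (hA : IsSelfAdjoint A)
    (h : ∀ x : H, 0 ≤ (inner ℂ x (A x)).re) : 0 ≤ A := by
  rw [ContinuousLinearMap.nonneg_iff_isPositive, ContinuousLinearMap.isPositive_def']
  refine ⟨hA, fun x => ?_⟩
  rw [ContinuousLinearMap.reApplyInnerSelf_apply, inner_re_symm]
  exact h x

theorem norm_sqrt_apply_sq [CompleteSpace H] {P : H →L[ℂ] H} (hP : 0 ≤ P) (x : H) :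
    ‖CFC.sqrt P x‖ ^ 2 = (inner ℂ x (P x)).re := by
  have hs : IsSelfAdjoint (CFC.sqrt P) := (CFC.sqrt_nonneg P).isSelfAdjoint
  conv_rhs => rw [← CFC.sqrt_mul_sqrt_self P hP]
  rw [mul_apply_eq_comp, ← hs.inner_apply, re_inner_self]

theorem one_add_nonneg_of_norm_le_one [CompleteSpace H] {A : H →L[ℂ] H} (hA : IsSelfAdjoint A)
    (h : ‖A‖ ≤ 1) : 0 ≤ 1 + A := by
  refine isPositive_of_re_inner_nonneg ((IsSelfAdjoint.one _).add hA) fun x => ?_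
  have h1 := re_inner_le_norm_mul (-x) (A x)
  have h2 : ‖A x‖ ≤ ‖x‖ := by simpa using A.le_of_opNorm_le h x
  rw [inner_neg_left, Complex.neg_re, norm_neg] at h1
  simp only [add_apply, one_apply_eq_self, inner_add_right,
    Complex.add_re, re_inner_self]
  nlinarith [norm_nonneg x]

theorem one_sub_nonneg_of_norm_le_one [CompleteSpace H] {A : H →L[ℂ] H} (hA : IsSelfAdjoint A)
    (h : ‖A‖ ≤ 1) : 0 ≤ 1 - A := by
  rw [sub_eq_add_neg]
  exact one_add_nonneg_of_norm_le_one hA.neg (by rwa [norm_neg])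

theorem numericalRange_subset_ellipseK [CompleteSpace H] {δ : ℝ} (hδ0 : 0 ≤ δ) (hδ1 : δ < 1)
    {A B : H →L[ℂ] H} (hA : IsSelfAdjoint A) (hA1 : ‖A‖ ≤ 1) (hB : ‖B‖ ≤ 1) :
    numericalRange (((2 * Real.sqrt δ : ℝ) : ℂ) • A +
      ((1 - δ : ℝ) : ℂ) • (CFC.sqrt (1 + A) * B * CFC.sqrt (1 - A))) ⊆ ellipseK δ := by
  rintro z ⟨u, hu, rfl⟩
  have hs : IsSelfAdjoint (CFC.sqrt (1 + A)) := (CFC.sqrt_nonneg _).isSelfAdjoint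
  have n1 := norm_sqrt_apply_sq (one_add_nonneg_of_norm_le_one hA hA1) u
  have n2 := norm_sqrt_apply_sq (one_sub_nonneg_of_norm_le_one hA hA1) u
  simp only [add_apply, sub_apply,
    one_apply_eq_self, inner_add_right, inner_sub_right,
    Complex.add_re, Complex.sub_re, re_inner_self, hu] at n1 n2
  have him : (inner ℂ u (A u)).im = 0 := by
    have := inner_conj_symm (𝕜 := ℂ) u (A u)
    rw [hA.inner_apply] at this
    exact Complex.conj_eq_iff_im.mp this
  simp only [ellipseK, Set.mem_ofPred_eq, add_apply,
    smul_apply, mul_apply_eq_comp, inner_add_right,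
    inner_smul_right, Complex.add_re, Complex.add_im, Complex.re_ofReal_mul,
    Complex.im_ofReal_mul, him, mul_zero, zero_add]
  rw [← hs.inner_apply]
  set w := inner ℂ (CFC.sqrt (1 + A) u) (B (CFC.sqrt (1 - A) u)) with hw
  set a := (inner ℂ u (A u)).re with ha
  have hw1 : ‖w‖ ≤ ‖CFC.sqrt (1 + A) u‖ * ‖CFC.sqrt (1 - A) u‖ := by
    refine (norm_inner_le_norm _ _).trans ?_
    gcongr
    simpa using B.le_of_opNorm_le hB (CFC.sqrt (1 - A) u)
  have hw2 : w.re ^ 2 + w.im ^ 2 ≤ 1 - a ^ 2 := by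
    have e : ‖w‖ ^ 2 ≤ (‖CFC.sqrt (1 + A) u‖ * ‖CFC.sqrt (1 - A) u‖) ^ 2 := by gcongr
    rw [mul_pow, n1, n2, ← Complex.normSq_eq_norm_sq, Complex.normSq_apply] at e
    nlinarith
  have hr := Real.sq_sqrt hδ0
  set r := Real.sqrt δ
  have h1 : ((1 - δ) * w.im) ^ 2 / (1 - δ) ^ 2 = w.im ^ 2 := by
    have : 1 - δ ≠ 0 := by linarith
    field_simp
  have h2 : (2 * r * a + (1 - δ) * w.re) ^ 2 / (1 + δ) ^ 2 ≤ a ^ 2 + w.re ^ 2 := by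
    rw [div_le_iff₀ (by positivity)]
    -- Lagrange's identity for the vectors `(a, Re w)` and `(2√δ, 1 - δ)`, the latter of length `1 +
    -- δ`.
    have e : (a ^ 2 + w.re ^ 2) * (1 + δ) ^ 2 = (2 * r * a + (1 - δ) * w.re) ^ 2
        + (2 * r * w.re - (1 - δ) * a) ^ 2 := by
      linear_combination (-4 * a ^ 2 - 4 * w.re ^ 2) * hr
    nlinarith [sq_nonneg (2 * r * w.re - (1 - δ) * a)]
  linarith

/-- Bounded sequences of operators on a finite-dimensional space have cluster points. -/
theorem exists_subseq_tendsto [FiniteDimensional ℂ H] {f : ℕ → H →L[ℂ] H} {C : ℝ}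
    (h : ∀ n, ‖f n‖ ≤ C) :
    ∃ a, ‖a‖ ≤ C ∧ ∃ φ : ℕ → ℕ, StrictMono φ ∧ Tendsto (f ∘ φ) atTop (𝓝 a) := by
  have : ProperSpace (H →L[ℂ] H) := FiniteDimensional.proper ℂ _
  obtain ⟨a, ha, φ, hφ, ht⟩ := (isCompact_closedBall (0 : H →L[ℂ] H) C).tendsto_subseq
    (x := f) (fun n => by simpa using h n)
  exact ⟨a, by simpa using ha, φ, hφ, ht⟩

/-- Parametrization of the off-diagonal entry of a positive `2 × 2` operator matrix. -/
theorem BlockPositive.exists_contraction [CompleteSpace H] [FiniteDimensional ℂ H]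
    {P R Q : H →L[ℂ] H} (hP : 0 ≤ P) (hQ : 0 ≤ Q) (h : BlockPositive P R Q) :
    ∃ B : H →L[ℂ] H, ‖B‖ ≤ 1 ∧ R = CFC.sqrt P * B * CFC.sqrt Q := by
  -- The roots need not be invertible, so they are shifted by `ε`. Since `√S ≥ 0`, `‖(√S + ε) v‖ ≥
  -- ‖√S v‖`, so `√S (√S + ε)⁻¹` is a contraction.
  have key : ∀ S : H →L[ℂ] H, 0 ≤ S → ∀ ε : ℝ, 0 < ε →
      ∃ V : H →L[ℂ] H, IsSelfAdjoint V ∧ (CFC.sqrt S + (ε : ℂ) • 1) * V = 1 ∧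
        V * (CFC.sqrt S + (ε : ℂ) • 1) = 1 ∧ ∀ x, ‖CFC.sqrt S (V x)‖ ≤ ‖x‖ := by
    intro S hS ε hε
    set p : H →L[ℂ] H := CFC.sqrt S + (ε : ℂ) • 1 with hp
    have hs0 : 0 ≤ CFC.sqrt S := CFC.sqrt_nonneg S
    have hpos : ∀ x, 0 ≤ (inner ℂ x (CFC.sqrt S x)).re := fun x =>
      (((ContinuousLinearMap.nonneg_iff_isPositive _).mp hs0).re_inner_nonneg_right x)
    have hpsa : IsSelfAdjoint p := hs0.isSelfAdjoint.add
      (IsSelfAdjoint.smul (Complex.conj_ofReal ε) (IsSelfAdjoint.one _))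
    have hpx : ∀ x, (inner ℂ x (p x)).re = (inner ℂ x (CFC.sqrt S x)).re + ε * ‖x‖ ^ 2 := by
      intro x
      simp only [hp, add_apply, smul_apply,
        one_apply_eq_self, inner_add_right, inner_smul_right, Complex.add_re,
        Complex.re_ofReal_mul, re_inner_self]
    obtain ⟨V, hV, h1, h2⟩ := exists_inverse_of_le_re_inner hpsa hε fun x => by
      rw [hpx]
      linarith [hpos x]
    refine ⟨V, hV, h1, h2, fun x => ?_⟩
    set v := V x with hv
    have hx : x = CFC.sqrt S v + (ε : ℂ) • v := by
      have := congrArg (fun W : H →L[ℂ] H => W x) h1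
      simpa [hp, ← hv] using this.symm
    have e : ‖x‖ ^ 2 = ‖CFC.sqrt S v‖ ^ 2 + 2 * (ε * (inner ℂ v (CFC.sqrt S v)).re)
        + ‖(ε : ℂ) • v‖ ^ 2 := by
      have := norm_add_sq (𝕜 := ℂ) (CFC.sqrt S v) ((ε : ℂ) • v)
      rw [inner_smul_right, ← hx] at this
      rw [this, re_inner_comm v]
      simp
    refine (abs_le_of_sq_le_sq' ?_ (norm_nonneg x)).2
    have := mul_nonneg hε.le (hpos v)
    nlinarith [sq_nonneg ‖(ε : ℂ) • v‖]
  let ε : ℕ → ℝ := fun n => 1 / ((n : ℝ) + 1)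
  have hε : ∀ n, 0 < ε n := fun n => by positivity
  choose V hVs hV1 hV2 hV3 using fun n => key P hP (ε n) (hε n)
  choose W hWs hW1 hW2 hW3 using fun n => key Q hQ (ε n) (hε n)
  have hB : ∀ n, ‖V n * R * W n‖ ≤ 1 := by
    intro n
    refine norm_le_of_neg_two_mul_re_inner_le fun x y => ?_
    have h1 := h (V n x) (W n y)
    rw [← norm_sqrt_apply_sq hP, ← norm_sqrt_apply_sq hQ] at h1
    have h2 : (inner ℂ x ((V n * R * W n) y)).re = (inner ℂ (V n x) (R (W n y))).re := by
      rw [(hVs n).inner_apply]; rfl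
    have h3 := pow_le_pow_left₀ (norm_nonneg _) (hV3 n x) 2
    have h4 := pow_le_pow_left₀ (norm_nonneg _) (hW3 n y) 2
    rw [h2]
    linarith
  -- `R = (√P + ε)(V R W)(√Q + ε)` holds for every `ε`; a cluster point of the contractions `V R W`
  -- gives the factorization as `ε → 0`.
  obtain ⟨B, hB1, φ, hφ, ht⟩ := exists_subseq_tendsto hB
  refine ⟨B, hB1, ?_⟩
  have hεt : Tendsto (fun n => ((ε (φ n) : ℝ) : ℂ)) atTop (𝓝 0) := by
    have : Tendsto ε atTop (𝓝 0) := tendsto_one_div_add_atTop_nhds_zero_nat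
    exact_mod_cast (Complex.continuous_ofReal.tendsto 0).comp (this.comp hφ.tendsto_atTop)
  have hl : ∀ S : H →L[ℂ] H, Tendsto (fun n => S + ((ε (φ n) : ℝ) : ℂ) • (1 : H →L[ℂ] H))
      atTop (𝓝 S) := by
    intro S
    simpa using tendsto_const_nhds.add (hεt.smul_const (1 : H →L[ℂ] H))
  have hlim := ((hl (CFC.sqrt P)).mul ht).mul (hl (CFC.sqrt Q))
  refine tendsto_nhds_unique (tendsto_const_nhds.congr fun n => ?_) hlim
  have e : (CFC.sqrt P + ((ε (φ n) : ℝ) : ℂ) • (1 : H →L[ℂ] H)) * (V (φ n) * R * W (φ n)) *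
      (CFC.sqrt Q + ((ε (φ n) : ℝ) : ℂ) • 1) = R := by
    rw [← mul_assoc, ← mul_assoc, hV1, one_mul, mul_assoc, hW2, mul_one]
  exact e.symm

end BlockPositive

/-! ### Ando's theorem on the numerical radius. -/

section Ando

variable {H : Type*} [NormedAddCommGroup H] [InnerProductSpace ℂ H]

open Filter Topology Finset ComplexConjugate

theorem IsPrimitiveRoot.sum_conj_pow_mul_pow {N : ℕ} {ω : ℂ} (hω : IsPrimitiveRoot ω N) {p q : ℕ}
    (hp : p < N) (hq : q < N) :
    ∑ k ∈ range N, conj (ω ^ (k * p)) * ω ^ (k * q) = if p = q then (N : ℂ) else 0 := by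
  have hN : N ≠ 0 := by omega
  have hn : ∀ m : ℕ, conj (ω ^ m) = (ω ^ m)⁻¹ := fun m =>
    (Complex.inv_eq_conj (by rw [norm_pow, hω.norm'_eq_one hN, one_pow])).symm
  have h0 : ω ≠ 0 := hω.ne_zero hN
  have e : ∀ k, conj (ω ^ (k * p)) * ω ^ (k * q) = ((ω ^ p)⁻¹ * ω ^ q) ^ k := fun k => by
    rw [hn, mul_pow, inv_pow, ← pow_mul, ← pow_mul, mul_comm k, mul_comm k]
  simp_rw [e]
  split_ifs with h
  · subst h
    rw [inv_mul_cancel₀ (pow_ne_zero _ h0)]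
    simp
  · have hz : (ω ^ p)⁻¹ * ω ^ q ≠ 1 := fun hz => by
      rw [inv_mul_eq_one₀ (pow_ne_zero _ h0)] at hz
      exact h (hω.pow_inj hp hq hz)
    have hzN : ((ω ^ p)⁻¹ * ω ^ q) ^ N = 1 := by
      rw [mul_pow, inv_pow, ← pow_mul, ← pow_mul, mul_comm p, mul_comm q, pow_mul, pow_mul,
        hω.pow_eq_one]
      simp
    rw [geom_sum_eq hz, hzN, sub_self, zero_div]

/-- A discrete Fourier transform extracts the `a`-th superdiagonal. The bound `m + a ≤ N` excludes
wrap-around: `j + a` and `l` stay below `N`. -/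
theorem IsPrimitiveRoot.sum_conj_pow_mul_inner {N : ℕ} {ω : ℂ} (hω : IsPrimitiveRoot ω N)
    (S : H →L[ℂ] H) (x : ℕ → H) {m a : ℕ} (hm : m + a ≤ N) :
    ∑ k ∈ range N, conj (ω ^ (k * a)) *
        inner ℂ (∑ j ∈ range m, ω ^ (k * j) • x j) (S (∑ j ∈ range m, ω ^ (k * j) • x j)) =
      N * ∑ j ∈ range m, ∑ l ∈ range m, if j + a = l then inner ℂ (x j) (S (x l)) else 0 := by
  have e : ∀ k ∈ range N, conj (ω ^ (k * a)) *
        inner ℂ (∑ j ∈ range m, ω ^ (k * j) • x j) (S (∑ j ∈ range m, ω ^ (k * j) • x j)) =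
      ∑ j ∈ range m, ∑ l ∈ range m,
        conj (ω ^ (k * (j + a))) * ω ^ (k * l) * inner ℂ (x j) (S (x l)) := by
    intro k _
    rw [map_sum, sum_inner, mul_sum]
    refine sum_congr rfl fun j _ => ?_
    rw [inner_sum, mul_sum]
    refine sum_congr rfl fun l _ => ?_
    rw [map_smul, inner_smul_left, inner_smul_right, mul_add, pow_add, map_mul]
    ring
  rw [sum_congr rfl e, sum_comm, mul_sum]
  refine sum_congr rfl fun j hj => ?_
  rw [sum_comm, mul_sum]
  refine sum_congr rfl fun l hl => ?_
  rw [mem_range] at hj hl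
  rw [← sum_mul, hω.sum_conj_pow_mul_pow (by omega) (by omega)]
  split_ifs <;> simp

/-- If the numerical radius of `S` is at most `r`, so is that of its tensor product with a
nilpotent Jordan block. -/
theorem norm_sum_inner_shift_le {S : H →L[ℂ] H} {r : ℝ}
    (hS : ∀ u : H, ‖inner ℂ u (S u)‖ ≤ r * ‖u‖ ^ 2) (n : ℕ) (x : ℕ → H) :
    ‖∑ i ∈ range n, inner ℂ (x i) (S (x (i + 1)))‖ ≤ r * ∑ i ∈ range (n + 1), ‖x i‖ ^ 2 := by
  have hN : n + 2 ≠ 0 := by omega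
  have hω := Complex.isPrimitiveRoot_exp (n + 2) hN
  set ω := Complex.exp (2 * Real.pi * Complex.I / ((n + 2 : ℕ) : ℂ))
  set u : ℕ → H := fun k => ∑ j ∈ range (n + 1), ω ^ (k * j) • x j
  -- Offset 1 extracts the shifted sum; offset 0 with the identity is Parseval for `∑ ‖u k‖ ^ 2`.
  have h1 := hω.sum_conj_pow_mul_inner S x (m := n + 1) (a := 1) (by omega)
  have h0 := hω.sum_conj_pow_mul_inner (1 : H →L[ℂ] H) x (m := n + 1) (a := 0) (by omega)
  have e1 : ∑ j ∈ range (n + 1), ∑ l ∈ range (n + 1),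
      (if j + 1 = l then inner ℂ (x j) (S (x l)) else 0) =
      ∑ i ∈ range n, inner ℂ (x i) (S (x (i + 1))) := by
    simp_rw [sum_ite_eq]
    rw [sum_range_succ _ n, if_neg (by simp), add_zero]
    refine sum_congr rfl fun j hj => if_pos ?_
    rw [mem_range] at hj ⊢
    omega
  have e0 : ∑ j ∈ range (n + 1), ∑ l ∈ range (n + 1),
      (if j + 0 = l then inner ℂ (x j) ((1 : H →L[ℂ] H) (x l)) else 0) =
      ((∑ i ∈ range (n + 1), ‖x i‖ ^ 2 : ℝ) : ℂ) := by
    simp_rw [add_zero, sum_ite_eq]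
    push_cast
    refine sum_congr rfl fun j hj => ?_
    rw [if_pos hj]
    exact inner_self_eq_norm_sq_to_K (𝕜 := ℂ) (x j)
  rw [e1] at h1
  rw [e0] at h0
  have h0' : ∑ k ∈ range (n + 2), ‖u k‖ ^ 2 = ((n + 2 : ℕ) : ℝ) * ∑ i ∈ range (n + 1), ‖x i‖ ^ 2 := by
    have := congrArg Complex.re h0
    simpa [u, re_inner_self, ← Complex.ofReal_pow, ← Complex.ofReal_sum] using this
  have hpos : (0 : ℝ) < ((n + 2 : ℕ) : ℝ) := by positivity
  refine le_of_mul_le_mul_left ?_ hpos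
  calc ((n + 2 : ℕ) : ℝ) * ‖∑ i ∈ range n, inner ℂ (x i) (S (x (i + 1)))‖
      = ‖((n + 2 : ℕ) : ℂ) * ∑ i ∈ range n, inner ℂ (x i) (S (x (i + 1)))‖ := by
        rw [norm_mul, Complex.norm_natCast]
    _ ≤ ∑ k ∈ range (n + 2), r * ‖u k‖ ^ 2 := by
        rw [← h1]
        refine (norm_sum_le _ _).trans (sum_le_sum fun k _ => ?_)
        rw [norm_mul, Complex.norm_conj, norm_pow, hω.norm'_eq_one hN, one_pow, one_mul]
        exact hS (u k)
    _ = _ := by rw [← mul_sum, h0']; ring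

/-- The quadratic form of the block tridiagonal Toeplitz operator with diagonal `2` and
superdiagonal `S`, truncated to `n + 1` blocks. -/
noncomputable def toeplitzForm (S : H →L[ℂ] H) (n : ℕ) (x : ℕ → H) : ℝ :=
  ∑ i ∈ range (n + 1), 2 * ‖x i‖ ^ 2 + 2 * ∑ i ∈ range n, (inner ℂ (x i) (S (x (i + 1)))).re

theorem le_toeplitzForm {S : H →L[ℂ] H} {r : ℝ} (hr : r ≤ 1)
    (hS : ∀ u : H, ‖inner ℂ u (S u)‖ ≤ r * ‖u‖ ^ 2) (n : ℕ) (x : ℕ → H) :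
    2 * (1 - r) * ‖x 0‖ ^ 2 ≤ toeplitzForm S n x := by
  have h := norm_sum_inner_shift_le hS n x
  have h1 := (Complex.abs_re_le_norm _).trans h
  rw [Complex.re_sum] at h1
  have h2 := (abs_le.mp h1).1
  have h3 : ‖x 0‖ ^ 2 ≤ ∑ i ∈ range (n + 1), ‖x i‖ ^ 2 :=
    single_le_sum (f := fun i => ‖x i‖ ^ 2) (fun i _ => by positivity) (by simp)
  rw [toeplitzForm, ← mul_sum]
  nlinarith

theorem toeplitzForm_succ (S : H →L[ℂ] H) (n : ℕ) (x : ℕ → H) :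
    toeplitzForm S (n + 1) x = 2 * ‖x 0‖ ^ 2 + 2 * (inner ℂ (x 0) (S (x 1))).re +
      toeplitzForm S n (fun i => x (i + 1)) := by
  rw [toeplitzForm, toeplitzForm, sum_range_succ',
    sum_range_succ' (fun i => (inner ℂ (x i) (S (x (i + 1)))).re)]
  ring

/-! ### Schur complements of the Toeplitz form. -/

variable [CompleteSpace H]

/-- Iterated Schur complements of the block tridiagonal Toeplitz operator with diagonal `2` and
superdiagonal `S`. -/
noncomputable def schurIterate (S : H →L[ℂ] H) : ℕ → H →L[ℂ] H
  | 0 => (2 : ℝ) • 1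
  | n + 1 => (2 : ℝ) • 1 - S * Ring.inverse (schurIterate S n) * star S

theorem schurIterate_succ_of_mul_eq_one {S V : H →L[ℂ] H} {n : ℕ} (h₁ : schurIterate S n * V = 1)
    (h₂ : V * schurIterate S n = 1) : schurIterate S (n + 1) = (2 : ℝ) • 1 - S * V * star S := by
  have : Ring.inverse (schurIterate S n) = V :=
    Ring.inverse_unit (⟨schurIterate S n, V, h₁, h₂⟩ : (H →L[ℂ] H)ˣ)
  rw [schurIterate, this]

theorem re_inner_two_sub {S V : H →L[ℂ] H} (x : H) :
    (inner ℂ x (((2 : ℝ) • (1 : H →L[ℂ] H) - S * V * star S) x)).re =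
      2 * ‖x‖ ^ 2 - (inner ℂ (star S x) (V (star S x))).re := by
  rw [ContinuousLinearMap.star_eq_adjoint, ContinuousLinearMap.adjoint_inner_left]
  simp only [sub_apply, smul_apply, one_apply_eq_self, mul_apply_eq_comp, inner_sub_right,
    Complex.sub_re, inner_smul_right_eq_smul, Complex.smul_re, re_inner_self, smul_eq_mul]

/-- Every value of the Schur complement is a value of the Toeplitz form, so the form's lower bound
passes to it and makes the next inverse exist; hence the joint induction. -/
theorem schurIterate_spec {S : H →L[ℂ] H} {r : ℝ} (hr : r < 1)
    (hS : ∀ u : H, ‖inner ℂ u (S u)‖ ≤ r * ‖u‖ ^ 2) (n : ℕ) :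
    IsSelfAdjoint (schurIterate S n) ∧
      ∀ x, ∃ y : ℕ → H, y 0 = x ∧ toeplitzForm S n y = (inner ℂ x (schurIterate S n x)).re := by
  induction n with
  | zero =>
    refine ⟨IsSelfAdjoint.smul (star_trivial _) (IsSelfAdjoint.one _), fun x => ⟨fun _ => x, rfl, ?_⟩⟩
    simp [toeplitzForm, schurIterate, inner_smul_right_eq_smul, ← Complex.ofReal_pow]
  | succ n ih =>
    obtain ⟨hsa, hy⟩ := ih
    obtain ⟨V, hV, h₁, h₂⟩ := exists_inverse_of_le_re_inner (c := 2 * (1 - r)) hsa (by linarith)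
      fun x => by
        obtain ⟨y, rfl, h⟩ := hy x
        exact h ▸ le_toeplitzForm hr.le hS n y
    rw [schurIterate_succ_of_mul_eq_one h₁ h₂]
    refine ⟨(IsSelfAdjoint.smul (star_trivial _) (IsSelfAdjoint.one _)).sub
      (hV.conjugate S), fun x => ?_⟩
    -- With `G` the current iterate, the choice `y₀ = -G⁻¹ S* x` minimizes `2 Re ⟨x, S y₀⟩ + ⟨y₀, G
    -- y₀⟩`.
    obtain ⟨y, hy0, hy1⟩ := hy (-(V (star S x)))
    refine ⟨fun i => Nat.casesOn i x y, rfl, ?_⟩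
    rw [toeplitzForm_succ, re_inner_two_sub]
    change 2 * ‖x‖ ^ 2 + 2 * (inner ℂ x (S (y 0))).re + toeplitzForm S n y = _
    have h3 : schurIterate S n (V (star S x)) = star S x := by
      rw [← mul_apply_eq_comp, h₁, one_apply_eq_self]
    rw [hy1, hy0, map_neg, map_neg, inner_neg_neg, h3, inner_neg_right, Complex.neg_re,
      re_inner_comm (V _), ContinuousLinearMap.star_eq_adjoint,
      ContinuousLinearMap.adjoint_inner_left]
    ring

theorem le_schurIterate {S : H →L[ℂ] H} {r : ℝ} (hr : r < 1)
    (hS : ∀ u : H, ‖inner ℂ u (S u)‖ ≤ r * ‖u‖ ^ 2) (n : ℕ) (x : H) :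
    2 * (1 - r) * ‖x‖ ^ 2 ≤ (inner ℂ x (schurIterate S n x)).re := by
  obtain ⟨y, rfl, h⟩ := (schurIterate_spec hr hS n).2 x
  exact h ▸ le_toeplitzForm hr.le hS n y

/-- Completing the square: the expression is the form of the `n`-th iterate at `V S* x + y`, where
`V` is the inverse of that iterate. -/
theorem schurIterate_block {S : H →L[ℂ] H} {r : ℝ} (hr : r < 1)
    (hS : ∀ u : H, ‖inner ℂ u (S u)‖ ≤ r * ‖u‖ ^ 2) (n : ℕ) (x y : H) :
    0 ≤ 2 * ‖x‖ ^ 2 - (inner ℂ x (schurIterate S (n + 1) x)).re +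
      2 * (inner ℂ x (S y)).re + (inner ℂ y (schurIterate S n y)).re := by
  have hpos := le_schurIterate hr hS n
  have hsa := (schurIterate_spec hr hS n).1
  obtain ⟨V, hV, h₁, h₂⟩ := exists_inverse_of_le_re_inner (c := 2 * (1 - r)) hsa (by linarith) hpos
  have h3 : schurIterate S n (V (star S x)) = star S x := by
    rw [← mul_apply_eq_comp, h₁, one_apply_eq_self]
  have h := hpos (V (star S x) + y)
  have h4 : (inner ℂ (V (star S x)) (schurIterate S n y)).re = (inner ℂ x (S y)).re := by
    rw [← hsa.inner_apply, h3, ContinuousLinearMap.star_eq_adjoint,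
      ContinuousLinearMap.adjoint_inner_left]
  have h5 : (inner ℂ y (star S x)).re = (inner ℂ x (S y)).re := by
    rw [re_inner_comm, ContinuousLinearMap.star_eq_adjoint, ContinuousLinearMap.adjoint_inner_left]
  have h6 : 0 ≤ 2 * (1 - r) * ‖V (star S x) + y‖ ^ 2 := by
    have : 0 ≤ 1 - r := by linarith
    positivity
  rw [schurIterate_succ_of_mul_eq_one h₁ h₂, re_inner_two_sub]
  simp only [map_add, inner_add_left, inner_add_right, Complex.add_re, h3, h4, h5] at h
  rw [re_inner_comm (V _)] at h
  linarith

theorem schurIterate_le {S : H →L[ℂ] H} {r : ℝ} (hr : r < 1)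
    (hS : ∀ u : H, ‖inner ℂ u (S u)‖ ≤ r * ‖u‖ ^ 2) (n : ℕ) (x : H) :
    (inner ℂ x (schurIterate S n x)).re ≤ 2 * ‖x‖ ^ 2 := by
  cases n with
  | zero => simp [schurIterate, inner_smul_right_eq_smul, ← Complex.ofReal_pow]
  | succ n =>
    have := schurIterate_block hr hS n x 0
    simp only [map_zero, inner_zero_right, Complex.zero_re] at this
    linarith

/-- An approximate version of Ando's theorem, for operators of numerical radius less than `1`. -/
theorem exists_approx_block {S : H →L[ℂ] H} {r : ℝ} (hr : r < 1)
    (hS : ∀ u : H, ‖inner ℂ u (S u)‖ ≤ r * ‖u‖ ^ 2) (N : ℕ) :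
    ∃ Z : H →L[ℂ] H, IsSelfAdjoint Z ∧ ‖Z‖ ≤ 1 ∧ ∀ x y : H,
      0 ≤ (inner ℂ x ((1 + Z) x)).re + 2 * (inner ℂ x (S y)).re + (inner ℂ y ((1 - Z) y)).re +
        2 / (N + 1) * ‖x‖ ^ 2 := by
  set c : ℝ := ((N : ℝ) + 1)⁻¹ with hc
  have hc0 : 0 < c := by positivity
  have hcN : c * (N + 1) = 1 := inv_mul_cancel₀ (by positivity)
  -- The block inequality involves two consecutive iterates; averaging over `n` makes the index
  -- shift an error of order `1 / (N + 1)`.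
  set Q : H →L[ℂ] H := c • ∑ n ∈ range (N + 1), schurIterate S n with hQ
  have hQx : ∀ x, (inner ℂ x (Q x)).re =
      c * ∑ n ∈ range (N + 1), (inner ℂ x (schurIterate S n x)).re := by
    intro x
    rw [hQ, smul_apply, _root_.sum_apply, inner_smul_right_eq_smul, inner_sum, Complex.smul_re,
      Complex.re_sum, smul_eq_mul]
  have hQs : IsSelfAdjoint Q := IsSelfAdjoint.smul (star_trivial _)
    (isSelfAdjoint_sum _ fun n _ => (schurIterate_spec hr hS n).1)
  have hlow : ∀ n x, 0 ≤ (inner ℂ x (schurIterate S n x)).re := fun n x =>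
    le_trans (by have : 0 ≤ 1 - r := by linarith
                 positivity) (le_schurIterate hr hS n x)
  have hQ0 : ∀ x, 0 ≤ (inner ℂ x (Q x)).re := fun x => by
    rw [hQx]
    exact mul_nonneg hc0.le (sum_nonneg fun n _ => hlow n x)
  have hQ2 : ∀ x, (inner ℂ x (Q x)).re ≤ 2 * ‖x‖ ^ 2 := fun x => by
    rw [hQx]
    have := sum_le_sum fun n (_ : n ∈ range (N + 1)) => schurIterate_le hr hS n x
    rw [sum_const, card_range, nsmul_eq_mul] at this
    push_cast at this
    calc _ ≤ c * ((N + 1) * (2 * ‖x‖ ^ 2)) := by gcongr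
      _ = _ := by rw [← mul_assoc, hcN, one_mul]
  have hZx : ∀ x, (inner ℂ x ((1 - Q) x)).re = ‖x‖ ^ 2 - (inner ℂ x (Q x)).re := fun x => by
    rw [sub_apply, one_apply_eq_self, inner_sub_right, Complex.sub_re, re_inner_self]
  have hZs : IsSelfAdjoint (1 - Q) := (IsSelfAdjoint.one _).sub hQs
  refine ⟨1 - Q, hZs, norm_le_one_of_re_inner_le hZs
    (fun x => by rw [hZx]; linarith [hQ0 x]) (fun x => by rw [hZx]; linarith [hQ2 x]),
    fun x y => ?_⟩
  have hs := sum_nonneg fun n (_ : n ∈ range (N + 1)) => schurIterate_block hr hS n x y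
  simp only [sum_add_distrib, sum_sub_distrib, sum_const, card_range, nsmul_eq_mul] at hs
  -- The two sums differ by the last iterate, which is nonnegative, minus the iterate at 0, which is
  -- at most 2.
  have ht : ∑ n ∈ range (N + 1), (inner ℂ x (schurIterate S (n + 1) x)).re + 2 * ‖x‖ ^ 2 ≥
      ∑ n ∈ range (N + 1), (inner ℂ x (schurIterate S n x)).re := by
    have := sum_range_succ (fun n => (inner ℂ x (schurIterate S n x)).re) (N + 1)
    rw [sum_range_succ'] at this
    linarith [hlow (N + 1) x, schurIterate_le hr hS 0 x]
  rw [add_apply, one_apply_eq_self, inner_add_right, Complex.add_re, hZx, re_inner_self,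
    sub_sub_cancel, hQx, hQx, div_eq_mul_inv, ← hc]
  push_cast at hs
  have hs' := mul_nonneg hc0.le hs
  have ht' := mul_le_mul_of_nonneg_left ht hc0.le
  have e : c * ((N + 1) * (2 * ‖x‖ ^ 2)) = 2 * ‖x‖ ^ 2 := by rw [← mul_assoc, hcN, one_mul]
  have e' : c * ((N + 1) * (2 * (inner ℂ x (S y)).re)) = 2 * (inner ℂ x (S y)).re := by
    rw [← mul_assoc, hcN, one_mul]
  nlinarith

/-- Ando's theorem: an operator of numerical radius at most `1` is the off-diagonal entry of a
positive operator matrix whose diagonal entries add up to `2`. -/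
theorem exists_blockPositive [FiniteDimensional ℂ H] {S : H →L[ℂ] H}
    (hS : ∀ u : H, ‖inner ℂ u (S u)‖ ≤ ‖u‖ ^ 2) :
    ∃ Z : H →L[ℂ] H, IsSelfAdjoint Z ∧ BlockPositive (1 + Z) S (1 - Z) := by
  let ε : ℕ → ℝ := fun n => 1 / ((n : ℝ) + 1)
  have hε : ∀ n, 0 < ε n := fun n => by positivity
  have hε1 : ∀ n, ε n ≤ 1 := fun n => by
    rw [div_le_one (by positivity)]
    linarith [(Nat.cast_nonneg n : (0 : ℝ) ≤ n)]
  -- Shrinking `S` makes its numerical radius strictly less than 1, as the inverses require.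
  have hSr : ∀ n, ∀ u : H, ‖inner ℂ u (((1 - ε n) • S) u)‖ ≤ (1 - ε n) * ‖u‖ ^ 2 := by
    intro n u
    have h0 : 0 ≤ 1 - ε n := by linarith [hε1 n]
    rw [smul_apply, inner_smul_right_eq_smul, norm_smul, Real.norm_of_nonneg h0]
    exact mul_le_mul_of_nonneg_left (hS u) h0
  choose Z hZs hZ1 hZb using fun n =>
    exists_approx_block (by linarith [hε n] : 1 - ε n < 1) (hSr n) n
  obtain ⟨A, -, φ, hφ, ht⟩ := exists_subseq_tendsto hZ1
  have hεt : Tendsto (fun n => ε (φ n)) atTop (𝓝 0) :=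
    tendsto_one_div_add_atTop_nhds_zero_nat.comp hφ.tendsto_atTop
  refine ⟨A, isClosed_eq continuous_star continuous_id |>.mem_of_tendsto ht
    (Eventually.of_forall fun n => hZs _), fun x y => ?_⟩
  have hA : ∀ x : H, Tendsto (fun n => (inner ℂ x (Z (φ n) x)).re) atTop
      (𝓝 (inner ℂ x (A x)).re) := fun x => by
    have h1 : Continuous fun W : H →L[ℂ] H => (inner ℂ x (W x)).re := by fun_prop
    exact (h1.tendsto A).comp ht
  have hlim := (((hA x).const_add (‖x‖ ^ 2)).add
    (((hεt.const_sub 1).mul_const (inner ℂ x (S y)).re).const_mul 2)).add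
    (((hA y).const_sub (‖y‖ ^ 2)).add ((hεt.const_mul 2).mul_const (‖x‖ ^ 2)))
  have h0 := ge_of_tendsto' (b := 0) hlim fun n => by
    have := hZb (φ n) x y
    simp only [add_apply, sub_apply, smul_apply, one_apply_eq_self, inner_add_right,
      inner_sub_right, Complex.add_re, Complex.sub_re, re_inner_self, inner_smul_right_eq_smul,
      Complex.smul_re, smul_eq_mul] at this
    have e : 2 / ((φ n : ℝ) + 1) = 2 * ε (φ n) := by rw [mul_one_div]
    rw [e] at this
    linarith
  simp only [add_apply, sub_apply, one_apply_eq_self, inner_add_right,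
    inner_sub_right, Complex.add_re, Complex.sub_re, re_inner_self]
  linarith

end Ando

/-! ### Reduction of the ellipse to the disc, and the rotation. -/

section EllipticalRange

variable {H : Type*} [NormedAddCommGroup H] [InnerProductSpace ℂ H] [CompleteSpace H]

/-- The affine image of `T` whose numerical range is the image of `W(T)` under the map taking
`K_δ` to the unit disc. -/
theorem norm_inner_le_of_numericalRange_subset {δ : ℝ} (hδ0 : 0 ≤ δ) (hδ1 : δ < 1)
    {T : H →L[ℂ] H} (hT : numericalRange T ⊆ ellipseK δ) (u : H) :
    ‖inner ℂ u (((1 - δ ^ 2)⁻¹ • (T - δ • star T)) u)‖ ≤ ‖u‖ ^ 2 := by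
  have hp : 1 + δ ≠ 0 := by linarith
  have hm : 1 - δ ≠ 0 := by linarith
  have hpm : 1 - δ ^ 2 = (1 + δ) * (1 - δ) := by ring
  have unit : ∀ v : H, ‖v‖ = 1 → ‖inner ℂ v (((1 - δ ^ 2)⁻¹ • (T - δ • star T)) v)‖ ≤ 1 := by
    intro v hv
    have hz : (inner ℂ v (T v)).re ^ 2 / (1 + δ) ^ 2 + (inner ℂ v (T v)).im ^ 2 / (1 - δ) ^ 2 ≤ 1 :=
      hT ⟨v, hv, rfl⟩
    have hc : inner ℂ v (star T v) = star (inner ℂ v (T v)) := by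
      rw [ContinuousLinearMap.star_eq_adjoint, ContinuousLinearMap.adjoint_inner_right]
      exact (inner_conj_symm (𝕜 := ℂ) (T v) v).symm
    rw [smul_apply, sub_apply, smul_apply, inner_smul_right_eq_smul, inner_sub_right,
      inner_smul_right_eq_smul, hc]
    -- With `z = ⟨v, T v⟩`, the number to be bounded is `Re z / (1 + δ) + i Im z / (1 - δ)`.
    refine (abs_le_of_sq_le_sq' ?_ zero_le_one).2
    rw [← Complex.normSq_eq_norm_sq, Complex.normSq_apply, one_pow]
    refine le_trans (le_of_eq ?_) hz
    simp only [Complex.smul_re, Complex.smul_im, Complex.sub_re, Complex.sub_im, Complex.star_def,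
      Complex.conj_re, Complex.conj_im, smul_eq_mul, hpm]
    field_simp
    ring
  rcases eq_or_ne u 0 with rfl | hu
  · simp
  · have hn : ‖u‖ ≠ 0 := norm_ne_zero_iff.mpr hu
    have h := unit (‖u‖⁻¹ • u) (by rw [norm_smul, norm_inv, norm_norm, inv_mul_cancel₀ hn])
    rw [ContinuousLinearMap.map_smul_of_tower, inner_smul_right_eq_smul, inner_smul_left_eq_smul,
      norm_smul, norm_smul, norm_inv, norm_norm, ← mul_assoc, ← mul_inv, inv_mul_le_iff₀
      (by positivity)] at h
    rwa [mul_one, ← sq] at h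

/-- A congruence of operator matrices by a real rotation of angle `arctan r`. -/
theorem BlockPositive.rotate {Z S : H →L[ℂ] H} (hZ : IsSelfAdjoint Z)
    (h : BlockPositive (1 + Z) S (1 - Z)) (r : ℝ) :
    BlockPositive (1 + (1 + r ^ 2)⁻¹ • ((1 - r ^ 2) • Z + r • (S + star S)))
      ((1 + r ^ 2)⁻¹ • (S - r ^ 2 • star S - (2 * r) • Z))
      (1 - (1 + r ^ 2)⁻¹ • ((1 - r ^ 2) • Z + r • (S + star S))) := by
  intro x y
  have hk : 0 < (1 + r ^ 2)⁻¹ := by positivity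
  have hk1 : (1 + r ^ 2)⁻¹ * (1 + r ^ 2) = 1 := inv_mul_cancel₀ (by positivity)
  have h1 := mul_nonneg hk.le (h (x - r • y) (r • x + y))
  have hs : ∀ a b : H, (inner ℂ a (star S b)).re = (inner ℂ b (S a)).re := fun a b => by
    rw [ContinuousLinearMap.star_eq_adjoint, ContinuousLinearMap.adjoint_inner_right,
      re_inner_comm]
  have hZs : (inner ℂ y (Z x)).re = (inner ℂ x (Z y)).re := by
    rw [← hZ.inner_apply, re_inner_comm]
  have hyx := re_inner_comm y x
  generalize (1 + r ^ 2)⁻¹ = k at *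
  simp only [add_apply, sub_apply, smul_apply, one_apply_eq_self, map_add, map_sub,
    ContinuousLinearMap.map_smul_of_tower, inner_add_left, inner_sub_left, inner_add_right,
    inner_sub_right, inner_smul_right_eq_smul, inner_smul_left_eq_smul, Complex.add_re,
    Complex.sub_re, Complex.smul_re, smul_eq_mul, re_inner_self, hs, hZs, hyx] at h1 ⊢
  refine h1.trans (le_of_eq ?_)
  linear_combination (‖x‖ ^ 2 + ‖y‖ ^ 2) * hk1

theorem exists_contractions_of_numericalRange_subset [FiniteDimensional ℂ H] {δ : ℝ}
    (hδ0 : 0 ≤ δ) (hδ1 : δ < 1) {T : H →L[ℂ] H} (hT : numericalRange T ⊆ ellipseK δ) :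
    ∃ A B : H →L[ℂ] H, IsSelfAdjoint A ∧ ‖A‖ ≤ 1 ∧ ‖B‖ ≤ 1 ∧
      T = ((2 * Real.sqrt δ : ℝ) : ℂ) • A +
        ((1 - δ : ℝ) : ℂ) • (CFC.sqrt (1 + A) * B * CFC.sqrt (1 - A)) := by
  obtain ⟨Z, hZ, hb⟩ :=
    exists_blockPositive (norm_inner_le_of_numericalRange_subset hδ0 hδ1 hT)
  set S := (1 - δ ^ 2)⁻¹ • (T - δ • star T) with hS
  have hr := Real.sq_sqrt hδ0
  set r := Real.sqrt δ
  -- The choice `r = √δ` makes the `Z` terms cancel in `2√δ A + (1 - δ) R`, leaving `S + δ S*`.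
  have hb' := hb.rotate hZ r
  have hTS : T = S + δ • star S := by
    have : 1 - δ ^ 2 ≠ 0 := by nlinarith
    rw [hS, star_smul, star_sub, star_smul, star_star, star_trivial (1 - δ ^ 2)⁻¹,
      star_trivial δ]
    match_scalars <;> field_simp <;> ring
  set A := (1 + r ^ 2)⁻¹ • ((1 - r ^ 2) • Z + r • (S + star S)) with hA
  set R := (1 + r ^ 2)⁻¹ • (S - r ^ 2 • star S - (2 * r) • Z) with hR
  have hAs : IsSelfAdjoint A := IsSelfAdjoint.smul (star_trivial _)
    ((IsSelfAdjoint.smul (star_trivial _) hZ).add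
      (IsSelfAdjoint.smul (star_trivial _) (IsSelfAdjoint.add_star_self S)))
  have hA1 : ‖A‖ ≤ 1 := by
    refine norm_le_one_of_re_inner_le hAs (fun x => ?_) (fun x => ?_)
    · have := hb' 0 x
      simp only [map_zero, inner_zero_left, Complex.zero_re, sub_apply, one_apply_eq_self,
        inner_sub_right, Complex.sub_re, re_inner_self] at this
      linarith
    · have := hb' x 0
      simp only [map_zero, inner_zero_right, Complex.zero_re, add_apply, one_apply_eq_self,
        inner_add_right, Complex.add_re, re_inner_self] at this
      linarith
  obtain ⟨B, hB, hRB⟩ := hb'.exists_contraction (one_add_nonneg_of_norm_le_one hAs hA1)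
    (one_sub_nonneg_of_norm_le_one hAs hA1)
  refine ⟨A, B, hAs, hA1, hB, ?_⟩
  rw [← hRB, Complex.coe_smul, Complex.coe_smul, hTS, hA, hR, hr]
  have : 1 + δ ≠ 0 := by linarith
  clear_value S r
  match_scalars
  · field_simp
    linear_combination (-2 : ℝ) * hr
  · field_simp
    linear_combination (-2 : ℝ) * hr
  · field_simp
    ring

end EllipticalRange

theorem mainTheorem5 {H : Type*} [NormedAddCommGroup H] [InnerProductSpace ℂ H] [CompleteSpace H]
    (δ : ℝ) (hδ0 : 0 ≤ δ) (hδ1 : δ < 1) :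
    (FiniteDimensional ℂ H → ∀ T : H →L[ℂ] H,
      (numericalRange T ⊆ ellipseK δ ↔
        ∃ A B : H →L[ℂ] H, IsSelfAdjoint A ∧ ‖A‖ ≤ 1 ∧ ‖B‖ ≤ 1 ∧
          T = ((2 * Real.sqrt δ : ℝ) : ℂ) • A +
            ((1 - δ : ℝ) : ℂ) • (CFC.sqrt (1 + A) * B * CFC.sqrt (1 - A)))) ∧
    (∀ T A B : H →L[ℂ] H, IsSelfAdjoint A → ‖A‖ ≤ 1 → ‖B‖ ≤ 1 →
      T = ((2 * Real.sqrt δ : ℝ) : ℂ) • A +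
        ((1 - δ : ℝ) : ℂ) • (CFC.sqrt (1 + A) * B * CFC.sqrt (1 - A)) →
      numericalRange T ⊆ ellipseK δ) := by
  refine ⟨fun _ T => ⟨exists_contractions_of_numericalRange_subset hδ0 hδ1, ?_⟩, ?_⟩
  · rintro ⟨A, B, hA, hA1, hB, rfl⟩
    exact numericalRange_subset_ellipseK hδ0 hδ1 hA hA1 hB
  · rintro T A B hA hA1 hB rfl
    exact numericalRange_subset_ellipseK hδ0 hδ1 hA hA1 hB
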